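/- A $\rho$-perturbation of $x\in\mathbb R^n$ is $\widetilde x = x+g$, where the coordinates of $g$ are independent Gaussians of mean $0$ and variance $\rho^2/n$; perturbations of different vectors are independent. Identify $\mathbb R^{n^\ell}$ with the tensors of order $\ell$ and side $n$, with the Euclidean (Frobenius) norm, and write $T(y^{(1)},\dots,y^{(\ell)})=\sum_{i_1,\dots,i_\ell} T_{i_1\cdots i_\ell}\, y^{(1)}_{i_1}\cdots y^{(\ell)}_{i_\ell}$. Let $\sigma_k(M)$ denote the $k$-th largest singular value of a matrix $M$ (equal to $0$ if $k$ exceeds the rank). (1) Let $\delta\in(0,1)$, let $\ell,n\ge 1$, and let $\mathcal V\subseteq\mathbb R^{n^\ell}$ be any subspace of dimension $\delta n^\ell$. Then there are tensors $T_1,\dots,T_r\in\mathcal V$ of unit norm such that, for every $\rho>0$ and all vectors $x^{(1)},\dots,x^{(\ell)}\in\mathbb R^n$, their $\rho$-perturbations satisfy $$\Pr\Big[\exists j\in[r]:\ \big|T_j(\widetilde x^{(1)},\dots,\widetilde x^{(\ell)})\big|\ \ge\ \rho^\ell\, n^{-3^\ell}\Big]\ \ge\ 1-\exp\!\big(-\delta\,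 n^{1/(2\ell)^\ell}\big).$$ (2) There is an absolute constant $C$ such that the following holds. Let $\delta\in(0,1)$, let $\ell,n\ge 1$ with $\delta n^\ell$ an integer, let $\eta\in\mathbb R$, and let $M$ be any $r\times n^\ell$ real matrix with $\sigma_{\delta n^\ell}(M)\ge\eta$. Then for every $\rho>0$ and all vectors $x^{(1)},\dots,x^{(\ell)}\in\mathbb R^n$, their $\rho$-perturbations satisfy $$\Pr\Big[\big\|M\big(\widetilde x^{(1)}\otimes\cdots\otimes\widetilde x^{(\ell)}\big)\big\|\ \ge\ \eta\,\rho^\ell\, n^{-3^{C\ell}}\Big]\ \ge\ 1-\exp\!\big(-\delta\, n^{1/3^\ell}\big).$$ -/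

import Mathlib

open MeasureTheory ProbabilityTheory

noncomputable section

/-- Real tensors of order `ℓ` and side `n`, that is `ℝ^(n^ℓ)`, with the Euclidean (Frobenius)
norm. -/
abbrev RealTensor (n ℓ : ℕ) : Type := EuclideanSpace ℝ (Fin ℓ → Fin n)

/-- The rank-one tensor `x 0 ⊗ x 1 ⊗ ⋯ ⊗ x (ℓ - 1)`. -/
def rankOneTensor {n ℓ : ℕ} (x : Fin ℓ → Fin n → ℝ) : RealTensor n ℓ :=
  WithLp.toLp 2 fun I => ∏ t, x t (I t)

/-- The multilinear form `T (x 0, …, x (ℓ - 1)) = ∑ I, T I * ∏ t, x t (I t)` of a tensor. -/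
def RealTensor.apply {n ℓ : ℕ} (T : RealTensor n ℓ) (x : Fin ℓ → Fin n → ℝ) : ℝ :=
  ∑ I : Fin ℓ → Fin n, T I * ∏ t, x t (I t)

/-- The law of a `ρ`-perturbation of `x ∈ ℝ^n`: to each coordinate of `x` an independent Gaussian
of mean `0` and variance `ρ ^ 2 / n` is added. -/
def perturbationLaw {n : ℕ} (ρ : ℝ) (x : Fin n → ℝ) : Measure (Fin n → ℝ) :=
  Measure.pi fun i => gaussianReal (x i) (ρ ^ 2 / n).toNNReal

/-- The joint law of independent `ρ`-perturbations of the vectors `x 0, …, x (ℓ - 1)`. -/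
def jointPerturbationLaw {n ℓ : ℕ} (ρ : ℝ) (x : Fin ℓ → Fin n → ℝ) :
    Measure (Fin ℓ → Fin n → ℝ) :=
  Measure.pi fun t => perturbationLaw ρ (x t)

/-- The `k`-th largest singular value `σ_k` of a matrix, counted from `k = 1`; it is `0` when `k`
exceeds the rank. Mathlib counts singular values from `0`. -/
def Matrix.sigma {r : ℕ} {ι : Type} [Fintype ι] [DecidableEq ι]
    (M : Matrix (Fin r) ι ℝ) (k : ℕ) : ℝ :=
  (Matrix.toEuclideanLin M).singularValues (k - 1)

end

/-!
Both parts follow from one statement (`exists_finset_small_ball`): a space `V` of tensors of order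
`t` and dimension greater than `t p n ^ (t - 1)` contains finitely many unit tensors such that, for
every centre, all of them are smaller than `ρ ^ t n ^ (-3 t (t + 1) / 2)` at the perturbed point
with probability at most `n ^ (-2 (p + 1))`.

The proof is by induction on the order. Fixing the first index of a tensor gives its `n` slices, of
order one less. The inner product of two tensors is the sum of those of their slices, so for some
`i` the `i`-th slices of the tensors in `V` fill a subspace `W` of dimension at least `dim V / n`,
and `w ∈ W` lifts to a tensor of `V` that is at most `n ^ (t / 2)` times longer than `w`
(`exists_submodule_bounded_lifts`). Passing to the tensors of `V` whose `i`-th slice vanishes costs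
at most `n ^ (t - 1)` dimensions, so this can be repeated `p + 1` times
(`exists_triangular_slices`). It gives indices `i 0, …, i p` and spaces `W 0, …, W p` to which
the induction hypothesis applies, and the lifts of `W a` vanish on the slices `i b` with `b < a`.

Reveal first the perturbations of all vectors but the first. If `w a ∈ W a` is then not small, the
lift of `w a` is a linear form in the first vector whose coefficient at `i a` is not small and whose
coefficients at `i b` vanish for `b < a`. Such a triangular system is integrated out one pivot at a
time, and the boundedness of the Gaussian density gives one factor `ε` for each success
(`pi_forall_abs_linear_lt_le`); no upper bound on the other terms is needed. The successes for
different `a` are dependent, but `ε ^ (number of successes)` is at most the average over `a` of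
`ε ^ (p + 1)` and the indicator of failure (`prod_ite_le_average`), so the failure probability
increases by only `ε ^ (p + 1)` with each order.

For a space of dimension `δ n ^ ℓ` one takes `p + 1 = ⌈δ n / ℓ⌉`, and `n ^ (-2 (p + 1))` is below
`exp (-δ n ^ (2 ^ (-ℓ)))` (`inv_sq_pow_le_exp`), which is stronger than both bounds of the theorem.
For a matrix `M`, the space `V` is the span of the leading right singular vectors, on which
`σ_k |⟨T, z⟩| ≤ ‖M z‖` for unit `T ∈ V`; the constant `C = 1` works.
-/

open scoped ENNReal NNReal

/-! ### Slices with bounded lifts -/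

/-- If the linear maps `A i` decompose the inner product of `E`, then the image of one of them
contains a subspace of dimension at least `dim E / card ι` whose vectors have preimages of
controlled norm. It is spanned by the eigenvectors of `A i ∘ (A i)†` whose eigenvalue is at least
`1 / (card ι * dim F)`: the operators `(A i)† ∘ A i` sum to the identity, so some `A i ∘ (A i)†` has
trace at least `dim E / card ι`; its eigenvalues are at most `1`, and the small ones contribute less
than `1 / card ι` in total, so that no dimension is lost to them. -/
theorem exists_submodule_bounded_lifts {ι E F : Type*} [Fintype ι] [Nonempty ι]
    [NormedAddCommGroup E] [InnerProductSpace ℝ E] [FiniteDimensional ℝ E]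
    [NormedAddCommGroup F] [InnerProductSpace ℝ F] [FiniteDimensional ℝ F]
    (A : ι → E →ₗ[ℝ] F) (hA : ∀ x y, ∑ i, inner ℝ (A i x) (A i y) = inner ℝ x y) :
    ∃ (i : ι) (W : Submodule ℝ F),
      Module.finrank ℝ E ≤ Fintype.card ι * Module.finrank ℝ W ∧
      ∀ w ∈ W, ∃ x, A i x = w ∧
        ‖x‖ ^ 2 ≤ Fintype.card ι * Module.finrank ℝ F * ‖w‖ ^ 2 := by
  classical
  have hsum : ∑ i, LinearMap.trace ℝ F (A i ∘ₗ (A i).adjoint) = Module.finrank ℝ E := by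
    have h1 : ∑ i, (A i).adjoint ∘ₗ A i = LinearMap.id := by
      refine LinearMap.ext fun x => ext_inner_right ℝ fun y => ?_
      have h2 : ∀ i, inner ℝ (((A i).adjoint ∘ₗ A i) x) y = inner ℝ (A i x) (A i y) := fun i => by
        rw [LinearMap.comp_apply, LinearMap.adjoint_inner_left]
      rw [LinearMap.sum_apply, sum_inner, Finset.sum_congr rfl fun i _ => h2 i]
      exact hA x y
    rw [Finset.sum_congr rfl fun i _ => LinearMap.trace_comp_comm' (A i).adjoint (A i),
      ← map_sum, h1, LinearMap.trace_id]
  obtain ⟨i, hi⟩ : ∃ i, (Module.finrank ℝ E : ℝ) ≤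
      Fintype.card ι * LinearMap.trace ℝ F (A i ∘ₗ (A i).adjoint) := by
    by_contra! h
    have h2 := Finset.sum_lt_sum_of_nonempty Finset.univ_nonempty fun i _ => h i
    rw [← Finset.mul_sum, hsum] at h2
    simp at h2
  have hnorm : ∀ x, ‖A i x‖ ^ 2 ≤ ‖x‖ ^ 2 := fun x => by
    rw [← real_inner_self_eq_norm_sq x, ← hA x x, ← real_inner_self_eq_norm_sq]
    exact Finset.single_le_sum (f := fun i => inner ℝ (A i x) (A i x))
      (fun j _ => real_inner_self_nonneg) (Finset.mem_univ i)
  have hS : (A i ∘ₗ (A i).adjoint).IsSymmetric := LinearMap.isSymmetric_self_comp_adjoint _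
  obtain ⟨m, hm⟩ : ∃ m, Module.finrank ℝ F = m := ⟨_, rfl⟩
  set lam : Fin m → ℝ := hS.eigenvalues hm with hlam
  set b : OrthonormalBasis (Fin m) ℝ F := hS.eigenvectorBasis hm with hb
  have hSb : ∀ j, A i ((A i).adjoint (b j)) = lam j • b j := fun j =>
    hS.apply_eigenvectorBasis hm j
  have hadj : ∀ v, ‖(A i).adjoint v‖ ^ 2 = inner ℝ (A i ((A i).adjoint v)) v := fun v => by
    rw [← LinearMap.adjoint_inner_right, real_inner_self_eq_norm_sq]
  have hlam_le : ∀ j, lam j ≤ 1 := fun j => by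
    have h1 : ‖(A i).adjoint (b j)‖ ^ 2 = lam j := by
      rw [hadj, hSb, real_inner_smul_left, real_inner_self_eq_norm_sq]; simp
    have h2 := hnorm ((A i).adjoint (b j))
    rw [h1, hSb, norm_smul, b.norm_eq_one, mul_one, Real.norm_eq_abs, sq_abs] at h2
    nlinarith
  have htr : LinearMap.trace ℝ F (A i ∘ₗ (A i).adjoint) = ∑ j, lam j :=
    hS.trace_eq_sum_eigenvalues hm
  rw [htr] at hi
  set N : ℕ := Fintype.card ι with hN
  set good : Finset (Fin m) := Finset.univ.filter fun j => 1 ≤ (N * m : ℝ) * lam j with hgood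
  refine ⟨i, Submodule.span ℝ (Set.range fun j : good => b j), ?_, ?_⟩
  · have hli : LinearIndependent ℝ fun j : good => b j :=
      (b.orthonormal.comp _ Subtype.val_injective).linearIndependent
    rw [finrank_span_eq_card hli, Fintype.card_coe]
    by_contra! hlt
    have hlt' : (N * good.card + 1 : ℝ) ≤ Module.finrank ℝ E := by exact_mod_cast hlt
    have hsplit : ∑ j, lam j = ∑ j ∈ good, lam j + ∑ j ∈ goodᶜ, lam j :=
      (Finset.sum_add_sum_compl good _).symm
    have hg : ∑ j ∈ good, lam j ≤ good.card := by
      simpa using Finset.sum_le_sum fun j (_ : j ∈ good) => hlam_le j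
    have hbad : ∀ j ∈ goodᶜ, (N * m : ℝ) * lam j < 1 := fun j hj => by
      simpa [hgood] using hj
    have hcard : (goodᶜ.card : ℝ) ≤ m := by
      exact_mod_cast (Finset.card_le_univ _).trans_eq (Fintype.card_fin m)
    have hb1 : (m : ℝ) ≤ ∑ j ∈ goodᶜ, (N * m : ℝ) * lam j := by
      rw [← Finset.mul_sum]
      have : (1 : ℝ) ≤ N * ∑ j ∈ goodᶜ, lam j := by
        have := mul_le_mul_of_nonneg_left hg (Nat.cast_nonneg (α := ℝ) N)
        rw [hsplit] at hi
        linarith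
      nlinarith [Nat.cast_nonneg (α := ℝ) m]
    rcases goodᶜ.eq_empty_or_nonempty with h0 | h0
    · rw [h0] at hsplit
      have hm0 : (m : ℝ) ≤ 0 := by simpa [h0] using hb1
      have hm0 : m = 0 := by exact_mod_cast le_antisymm hm0 (Nat.cast_nonneg m)
      subst hm0
      simp only [Finset.univ_eq_empty, Finset.sum_empty, mul_zero] at hi
      have : (0 : ℝ) ≤ N * good.card := by positivity
      linarith
    · -- At most `m` eigenvalues are below the threshold `1 / (N * m)`, so they add up to
      -- less than `1 / N`.
      have := Finset.sum_lt_sum_of_nonempty h0 hbad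
      simp only [Finset.sum_const, nsmul_eq_mul, mul_one] at this
      linarith
  · intro w hw
    obtain ⟨c, rfl⟩ := (Submodule.mem_span_range_iff_exists_fun ℝ).1 hw
    have hpos : ∀ j ∈ good, 0 < lam j := fun j hj => by
      have h1 : 1 ≤ (N * m : ℝ) * lam j := by simpa [hgood] using hj
      by_contra! h
      have : (N * m : ℝ) * lam j ≤ 0 := mul_nonpos_of_nonneg_of_nonpos (by positivity) h
      linarith
    -- `A i ∘ (A i)†` is inverted on the chosen eigenvectors, and `(A i)†` yields the lift.
    set u : F := ∑ j : good, (c j / lam j) • b j with hu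
    have hSu : A i ((A i).adjoint u) = ∑ j : good, c j • b j := by
      rw [hu, map_sum, map_sum]
      refine Finset.sum_congr rfl fun j _ => ?_
      rw [map_smul, map_smul, hSb, smul_smul, div_mul_cancel₀ _ (hpos j j.2).ne']
    have hon : Orthonormal ℝ fun j : good => b j := b.orthonormal.comp _ Subtype.val_injective
    refine ⟨(A i).adjoint u, hSu, ?_⟩
    rw [hadj, hSu, hu, hon.inner_sum, ← real_inner_self_eq_norm_sq, hon.inner_sum, hm,
      Finset.mul_sum]
    refine Finset.sum_le_sum fun j _ => ?_
    have h1 : 1 ≤ (N * m : ℝ) * lam j := (Finset.mem_filter.1 j.2).2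
    have h2 := hpos j j.2
    simp only [conj_trivial]
    rw [mul_div_assoc', div_le_iff₀ h2]
    nlinarith [mul_self_nonneg (c j)]

/-- Linear map taking a tensor of order `t + 1` to its slice at the value `i` of the first index. -/
noncomputable def sliceMap {n t : ℕ} (i : Fin n) : RealTensor n (t + 1) →ₗ[ℝ] RealTensor n t where
  toFun T := WithLp.toLp 2 fun J => T (Fin.cons i J)
  map_add' _ _ := rfl
  map_smul' _ _ := rfl

theorem sliceMap_apply {n t : ℕ} (i : Fin n) (T : RealTensor n (t + 1)) (J : Fin t → Fin n) :
    sliceMap i T J = T (Fin.cons i J) := rfl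

theorem sum_fin_cons {n t : ℕ} (f : (Fin (t + 1) → Fin n) → ℝ) :
    ∑ I, f I = ∑ i, ∑ J : Fin t → Fin n, f (Fin.cons i J) := by
  rw [← Fintype.sum_prod_type']
  exact (Fintype.sum_equiv (Fin.consEquiv fun _ => Fin n) _ _ fun _ => rfl).symm

theorem sum_inner_sliceMap {n t : ℕ} (S T : RealTensor n (t + 1)) :
    ∑ i, inner ℝ (sliceMap i S) (sliceMap i T) = inner ℝ S T := by
  simp only [PiLp.inner_apply, sliceMap_apply, sum_fin_cons fun I => inner ℝ (S I) (T I)]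

theorem apply_cons {n t : ℕ} (T : RealTensor n (t + 1)) (y : Fin n → ℝ) (z : Fin t → Fin n → ℝ) :
    T.apply (Fin.cons y z) = ∑ i, (sliceMap i T).apply z * y i := by
  simp only [RealTensor.apply]
  rw [sum_fin_cons]
  refine Finset.sum_congr rfl fun i _ => ?_
  rw [Finset.sum_mul]
  refine Finset.sum_congr rfl fun J _ => ?_
  simp only [Fin.prod_univ_succ, Fin.cons_zero, Fin.cons_succ, sliceMap_apply]
  ring

theorem apply_smul {n t : ℕ} (c : ℝ) (T : RealTensor n t) (y : Fin t → Fin n → ℝ) :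
    (c • T).apply y = c * T.apply y := by
  simp [RealTensor.apply, Finset.mul_sum, mul_assoc]

theorem measurable_apply {n t : ℕ} (T : RealTensor n t) : Measurable T.apply := by
  unfold RealTensor.apply
  fun_prop

theorem apply_eq_inner {n t : ℕ} (T : RealTensor n t) (y : Fin t → Fin n → ℝ) :
    T.apply y = inner ℝ T (rankOneTensor y) := by
  simp [RealTensor.apply, rankOneTensor, PiLp.inner_apply, mul_comm]

theorem finrank_realTensor (n t : ℕ) : Module.finrank ℝ (RealTensor n t) = n ^ t := by
  simp

/-- A large space `V` of tensors of order `t + 1` has `s` slices, each carrying a large space `W a`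
of tensors of order `t` with bounded lifts to `V`, such that the lifts for a slice vanish on all
earlier chosen slices. Each step passes to the tensors of `V` that vanish on the slices chosen so
far, which costs at most `n ^ t` dimensions; only the first `s - 1` choices have to be paid for,
hence the summand `n ^ t` on the right of the hypothesis. -/
theorem exists_triangular_slices {n t : ℕ} (hn : 1 ≤ n) (N s : ℕ)
    (V : Submodule ℝ (RealTensor n (t + 1))) (hV : N + s * n ^ t < Module.finrank ℝ V + n ^ t) :
    ∃ (i : Fin s → Fin n) (W : Fin s → Submodule ℝ (RealTensor n t)),
      (∀ a, N < n * Module.finrank ℝ (W a)) ∧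
      ∀ a, ∀ w ∈ W a, ∃ T ∈ V, (∀ b < a, sliceMap (i b) T = 0) ∧ sliceMap (i a) T = w ∧
        ‖T‖ ^ 2 ≤ (n : ℝ) ^ (t + 1) * ‖w‖ ^ 2 := by
  induction s generalizing V with
  | zero => exact ⟨Fin.elim0, Fin.elim0, fun a => a.elim0, fun a => a.elim0⟩
  | succ s ih =>
    have : Nonempty (Fin n) := ⟨⟨0, hn⟩⟩
    obtain ⟨i₀, W₀, hdim, hlift⟩ :=
      exists_submodule_bounded_lifts (fun i => (sliceMap (n := n) (t := t) i) ∘ₗ V.subtype)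
        fun x y => by simpa using sum_inner_sliceMap (x : RealTensor n (t + 1)) y
    rw [Fintype.card_fin] at hdim
    set V' := V ⊓ LinearMap.ker (sliceMap (n := n) (t := t) i₀) with hV'
    have hdim' : Module.finrank ℝ V ≤ Module.finrank ℝ V' + n ^ t := by
      have h1 := LinearMap.finrank_range_add_finrank_ker (sliceMap i₀ ∘ₗ V.subtype)
      have h2 := Submodule.finrank_le (LinearMap.range (sliceMap i₀ ∘ₗ V.subtype))
      have h3 : Module.finrank ℝ (LinearMap.ker (sliceMap i₀ ∘ₗ V.subtype)) =
          Module.finrank ℝ V' := by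
        rw [LinearMap.ker_comp, hV', ← Submodule.map_comap_subtype,
          Submodule.finrank_map_subtype_eq]
      rw [finrank_realTensor] at h2
      omega
    rw [Nat.succ_mul] at hV
    obtain ⟨i, W, hW, hT⟩ := ih V' (by omega)
    refine ⟨Fin.cons i₀ i, Fin.cons W₀ W, Fin.cases ?_ hW, Fin.cases ?_ ?_⟩
    · rw [Fin.cons_zero]
      have : 0 ≤ s * n ^ t := Nat.zero_le _
      omega
    · intro w hw
      obtain ⟨T, hTw, hTn⟩ := hlift w hw
      refine ⟨T, T.2, fun b hb => absurd hb (Fin.not_lt_zero b), by simpa using hTw, ?_⟩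
      rw [Fintype.card_fin, finrank_realTensor] at hTn
      rw [pow_succ' (n : ℝ)]
      exact_mod_cast hTn
    · intro a w hw
      obtain ⟨T, hTV, h0, hTw, hTn⟩ := hT a w hw
      refine ⟨T, hTV.1, Fin.cases (fun _ => hTV.2) (fun b hb => ?_), hTw, hTn⟩
      exact h0 b (Fin.succ_lt_succ_iff.1 hb)

/-! ### Triangular small ball probabilities -/

theorem gaussianReal_abs_mul_add_lt_le (m : ℝ) {v : ℝ≥0} (hv : v ≠ 0) {κ τ c d : ℝ} (hκ : 0 < κ)
    (hc : κ ≤ |c|) :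
    gaussianReal m v {z | |c * z + d| < τ} ≤
      ENNReal.ofReal (2 * τ / (κ * √(2 * Real.pi * v))) := by
  have hc0 : c ≠ 0 := by rintro rfl; simp at hc; linarith
  have hv' : 0 < (v : ℝ) := by positivity
  have hsub : {z | |c * z + d| < τ} ⊆ Metric.ball (-d / c) (τ / κ) := by
    intro z hz
    have h1 : c * z + d = c * (z - -d / c) := by field_simp; ring
    rw [Set.mem_ofPred_eq, h1, abs_mul] at hz
    rw [Metric.mem_ball, Real.dist_eq, lt_div_iff₀' hκ]
    exact (mul_le_mul_of_nonneg_right hc (abs_nonneg _)).trans_lt hz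
  refine (measure_mono hsub).trans ?_
  rw [gaussianReal_apply m hv]
  calc ∫⁻ x in Metric.ball (-d / c) (τ / κ), gaussianPDF m v x
      ≤ ∫⁻ _ in Metric.ball (-d / c) (τ / κ), ENNReal.ofReal (√(2 * Real.pi * v))⁻¹ := by
        refine lintegral_mono fun x => ENNReal.ofReal_le_ofReal ?_
        rw [gaussianPDFReal]
        refine mul_le_of_le_one_right (by positivity) (Real.exp_le_one_iff.2 ?_)
        rw [neg_div]
        exact neg_nonpos.2 (by positivity)
    _ = ENNReal.ofReal (2 * τ / (κ * √(2 * Real.pi * v))) := by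
        rw [setLIntegral_const, Real.volume_ball, ← ENNReal.ofReal_mul (by positivity)]
        congr 1
        field_simp

/-- If `S` does not depend on the coordinate `i`, the small ball event of an affine form in that
coordinate costs a factor `ε`. -/
theorem pi_abs_linear_lt_inter_le {n : ℕ} (μ : Fin n → Measure ℝ) [∀ i, IsProbabilityMeasure (μ i)]
    {ε : ℝ≥0∞} {τ : ℝ} (c : Fin n → ℝ) (i : Fin n)
    (hε : ∀ d, μ i {z | |c i * z + d| < τ} ≤ ε) (S : Set (Fin n → ℝ)) (hS : MeasurableSet S)
    (hSi : ∀ y z, Function.update y i z ∈ S ↔ y ∈ S) :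
    Measure.pi μ ({y | |∑ j, c j * y j| < τ} ∩ S) ≤ ε * Measure.pi μ S := by
  have hm : MeasurableSet {y : Fin n → ℝ | |∑ j, c j * y j| < τ} :=
    measurableSet_lt (by fun_prop) measurable_const
  rw [← lintegral_indicator_one (hm.inter hS), ← lintegral_indicator_one hS,
    ← lintegral_const_mul _ (measurable_one.indicator hS)]
  refine lintegral_le_of_lmarginal_le {i} (measurable_one.indicator (hm.inter hS))
    ((measurable_one.indicator hS).const_mul _) fun y => ?_
  rw [lmarginal_singleton, lmarginal_singleton]
  by_cases hy : y ∈ S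
  · have h1 : ∀ z, (S.indicator 1 (Function.update y i z) : ℝ≥0∞) = 1 := fun z =>
      Set.indicator_of_mem ((hSi y z).2 hy) _
    simp only [h1, mul_one, lintegral_const, measure_univ]
    refine le_trans (le_of_eq ?_) (hε (∑ j ∈ Finset.univ.erase i, c j * y j))
    have hm' : MeasurableSet {z | |c i * z + ∑ j ∈ Finset.univ.erase i, c j * y j| < τ} :=
      measurableSet_lt (by fun_prop) measurable_const
    rw [← lintegral_indicator_one hm']
    refine lintegral_congr fun z => ?_
    have h2 : ∑ j, c j * Function.update y i z j =
        c i * z + ∑ j ∈ Finset.univ.erase i, c j * y j := by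
      rw [← Finset.add_sum_erase _ _ (Finset.mem_univ i)]
      simp only [Function.update_self]
      congr 1
      refine Finset.sum_congr rfl fun j hj => ?_
      rw [Function.update_of_ne (Finset.ne_of_mem_erase hj)]
    have h3 : Function.update y i z ∈ {y | |∑ j, c j * y j| < τ} ∩ S ↔
        z ∈ {z | |c i * z + ∑ j ∈ Finset.univ.erase i, c j * y j| < τ} := by
      simp only [Set.mem_inter_iff, Set.mem_ofPred_eq, h2, hSi, hy, and_true]
    by_cases hz : z ∈ {z | |c i * z + ∑ j ∈ Finset.univ.erase i, c j * y j| < τ}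
    · rw [Set.indicator_of_mem (h3.2 hz), Set.indicator_of_mem hz]; rfl
    · rw [Set.indicator_of_notMem (mt h3.1 hz), Set.indicator_of_notMem hz]
  · have h1 : ∀ z, Function.update y i z ∉ S := fun z h => hy ((hSi y z).1 h)
    have h2 : ∀ z, Function.update y i z ∉ ({y | |∑ j, c j * y j| < τ} ∩ S) :=
      fun z h => h1 z h.2
    simp [Set.indicator_of_notMem (h2 _)]

/-- A triangular system of linear forms: the form `c a` ignores the pivot coordinates of the earlier
forms, so that integrating the pivots out in order yields one factor `ε` for each form of `G`. -/
theorem pi_forall_abs_linear_lt_le {n s : ℕ} (μ : Fin n → Measure ℝ)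
    [∀ i, IsProbabilityMeasure (μ i)] (ε : ℝ≥0∞) (τ : ℝ) (c : Fin s → Fin n → ℝ)
    (i : Fin s → Fin n) (G : Set (Fin s)) [DecidablePred (· ∈ G)]
    (h0 : ∀ a ∈ G, ∀ b < a, c a (i b) = 0)
    (hε : ∀ a ∈ G, ∀ d, μ (i a) {z | |c a (i a) * z + d| < τ} ≤ ε) :
    Measure.pi μ {y | ∀ a ∈ G, |∑ j, c a j * y j| < τ} ≤ ∏ a, if a ∈ G then ε else 1 := by
  induction s with
  | zero => simp
  | succ s ih =>
    set S : Set (Fin n → ℝ) := {y | ∀ a : Fin s, a.succ ∈ G → |∑ j, c a.succ j * y j| < τ} with hS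
    have hSle : Measure.pi μ S ≤ ∏ a : Fin s, if a.succ ∈ G then ε else 1 :=
      ih (fun a => c a.succ) (fun a => i a.succ) {a | a.succ ∈ G}
        (fun a ha b hb => h0 _ ha _ (Fin.succ_lt_succ_iff.2 hb)) (fun a ha => hε _ ha)
    rw [Fin.prod_univ_succ]
    by_cases hG : (0 : Fin (s + 1)) ∈ G
    · rw [if_pos hG]
      have hSm : MeasurableSet S := by
        rw [hS]
        simp only [Set.ofPred_forall]
        exact MeasurableSet.iInter fun a => MeasurableSet.iInter fun _ =>
          measurableSet_lt (by fun_prop) measurable_const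
      have hSi : ∀ y z, Function.update y (i 0) z ∈ S ↔ y ∈ S := fun y z => by
        simp only [hS, Set.mem_ofPred_eq]
        refine forall_congr' fun a => forall_congr' fun ha => ?_
        have : ∑ j, c a.succ j * Function.update y (i 0) z j = ∑ j, c a.succ j * y j := by
          refine Finset.sum_congr rfl fun j _ => ?_
          rcases eq_or_ne j (i 0) with rfl | hj
          · rw [h0 _ ha 0 (Fin.succ_pos a), zero_mul, zero_mul]
          · rw [Function.update_of_ne hj]
        rw [this]
      have hsub : {y : Fin n → ℝ | ∀ a ∈ G, |∑ j, c a j * y j| < τ} ⊆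
          {y | |∑ j, c 0 j * y j| < τ} ∩ S := fun y hy => ⟨hy 0 hG, fun a ha => hy _ ha⟩
      exact (measure_mono hsub).trans
        ((pi_abs_linear_lt_inter_le μ (c 0) (i 0) (hε 0 hG) S hSm hSi).trans (by gcongr))
    · rw [if_neg hG, one_mul]
      have hsub : {y : Fin n → ℝ | ∀ a ∈ G, |∑ j, c a j * y j| < τ} ⊆ S :=
        fun y hy a ha => hy _ ha
      exact (measure_mono hsub).trans hSle

/-- Mixing successes (factor `ε`) and failures (factor `1`): by the inequality of arithmetic and
geometric means the product is at most the average of the powers `ε ^ s` and `1`. -/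
theorem prod_ite_le_average {s : ℕ} (hs : s ≠ 0) (ε : ℝ≥0) (G : Set (Fin s))
    [DecidablePred (· ∈ G)] :
    (∏ a, if a ∈ G then (ε : ℝ≥0∞) else 1) ≤
      (s : ℝ≥0∞)⁻¹ * ∑ a, ((ε : ℝ≥0∞) ^ s + Gᶜ.indicator 1 a) := by
  have hs' : (s : ℝ≥0) ≠ 0 := by exact_mod_cast hs
  have h := NNReal.geom_mean_le_arith_mean_weighted Finset.univ (fun _ : Fin s => (s : ℝ≥0)⁻¹)
    (fun a => (if a ∈ G then ε else 1) ^ s) (by simp [hs'])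
  have h1 : ∀ x : ℝ≥0, (x ^ s) ^ (((s : ℝ≥0)⁻¹ : ℝ≥0) : ℝ) = x := fun x => by
    rw [NNReal.coe_inv, NNReal.coe_natCast]
    exact NNReal.pow_rpow_inv_natCast x hs
  simp only [h1, ← Finset.mul_sum] at h
  have h2 : ((∏ a, if a ∈ G then ε else 1 : ℝ≥0) : ℝ≥0∞) ≤
      (((s : ℝ≥0)⁻¹ * ∑ a, (if a ∈ G then ε else 1) ^ s : ℝ≥0) : ℝ≥0∞) := by exact_mod_cast h
  push_cast [ENNReal.coe_inv hs'] at h2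
  refine le_trans (le_of_eq ?_) (h2.trans ?_)
  · exact Finset.prod_congr rfl fun a _ => by split_ifs <;> simp
  · gcongr with a
    by_cases ha : a ∈ G <;> simp [ha]

/-! ### Anticoncentration for a space of tensors -/

instance {n : ℕ} (ρ : ℝ) (x : Fin n → ℝ) : IsProbabilityMeasure (perturbationLaw ρ x) := by
  unfold perturbationLaw; infer_instance

instance {n ℓ : ℕ} (ρ : ℝ) (x : Fin ℓ → Fin n → ℝ) :
    IsProbabilityMeasure (jointPerturbationLaw ρ x) := by
  unfold jointPerturbationLaw; infer_instance

theorem jointPerturbationLaw_succ_apply {n t : ℕ} (ρ : ℝ) (x : Fin (t + 1) → Fin n → ℝ)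
    {B : Set (Fin (t + 1) → Fin n → ℝ)} (hB : MeasurableSet B) :
    jointPerturbationLaw ρ x B =
      ∫⁻ z, perturbationLaw ρ (x 0) {y | (Fin.cons y z : Fin (t + 1) → Fin n → ℝ) ∈ B}
        ∂jointPerturbationLaw ρ fun s => x s.succ := by
  have h := (measurePreserving_piFinSuccAbove (fun s => perturbationLaw ρ (x s)) 0).symm
  rw [jointPerturbationLaw, ← h.measure_preimage_equiv, Measure.prod_apply_symm
    (h.measurable hB)]
  simp only [Fin.zero_succAbove]
  refine lintegral_congr fun z => congrArg _ ?_
  ext y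
  simp [MeasurableEquiv.piFinSuccAbove, Fin.consEquiv]

theorem measurableSet_forall_abs_apply_lt {n t : ℕ} (F : Finset (RealTensor n t)) (τ : ℝ) :
    MeasurableSet {y : Fin t → Fin n → ℝ | ∀ T ∈ F, |T.apply y| < τ} := by
  have h : {y : Fin t → Fin n → ℝ | ∀ T ∈ F, |T.apply y| < τ} =
      ⋂ T ∈ F, {y | |T.apply y| < τ} := by ext; simp
  rw [h]
  exact F.measurableSet_biInter fun T _ =>
    measurableSet_lt (measurable_apply T).abs measurable_const

/-- The threshold `ρ ^ t * n ^ (-3 * t * (t + 1) / 2)` for tensors of order `t`, written as a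
recursion: each order costs a factor `ρ / n ^ (3 * (t + 1))`. -/
noncomputable def smallBallRadius (n : ℕ) (ρ : ℝ) : ℕ → ℝ
  | 0 => 1
  | t + 1 => smallBallRadius n ρ t * (ρ / (n : ℝ) ^ (3 * (t + 1)))

theorem smallBallRadius_pos {n : ℕ} (hn : 1 ≤ n) {ρ : ℝ} (hρ : 0 < ρ) (t : ℕ) :
    0 < smallBallRadius n ρ t := by
  have : (0 : ℝ) < n := by exact_mod_cast hn
  induction t with
  | zero => exact one_pos
  | succ t ih => rw [smallBallRadius]; positivity

theorem three_pow_add_three_mul_le {t : ℕ} (ht : 1 ≤ t) : 3 ^ t + 3 * (t + 1) ≤ 3 ^ (t + 1) := by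
  induction t, ht using Nat.le_induction with
  | base => norm_num
  | succ t _ ih => rw [pow_succ 3 (t + 1)]; omega

theorem le_smallBallRadius {n : ℕ} (hn : 1 ≤ n) {ρ : ℝ} (hρ : 0 < ρ) (t : ℕ) :
    ρ ^ t * (1 / (n : ℝ)) ^ (3 ^ t) ≤ smallBallRadius n ρ t := by
  have hn' : (1 : ℝ) ≤ n := by exact_mod_cast hn
  have hinv : 1 / (n : ℝ) ≤ 1 := by rw [div_le_one (by linarith)]; exact hn'
  induction t with
  | zero => simpa [smallBallRadius] using hinv
  | succ t ih =>
    rw [smallBallRadius]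
    rcases Nat.eq_zero_or_pos t with rfl | ht
    · simp [smallBallRadius, div_eq_mul_inv]
    calc ρ ^ (t + 1) * (1 / (n : ℝ)) ^ (3 ^ (t + 1))
        ≤ ρ ^ (t + 1) * (1 / (n : ℝ)) ^ (3 ^ t + 3 * (t + 1)) := by
          gcongr ?_ * ?_
          exact pow_le_pow_of_le_one (by positivity) hinv (three_pow_add_three_mul_le ht)
      _ = (ρ ^ t * (1 / (n : ℝ)) ^ (3 ^ t)) * (ρ / (n : ℝ) ^ (3 * (t + 1))) := by
          rw [pow_add (1 / (n : ℝ)), one_div_pow (n : ℝ) (3 * (t + 1))]; ring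
      _ ≤ _ := by gcongr

/-- The factor `ε` of one success in the step from order `t` to `t + 1`: the Gaussian has variance
`ρ ^ 2 / n`, and after normalizing the lift its pivot coefficient is at least
`τ / n ^ ((t + 1) / 2)`. The constants rest on `2 * π ≥ (5 / 2) ^ 2` and `n ^ 5 ≥ 25`. -/
theorem gaussian_small_ball_constant_le {n : ℕ} (hn : 2 ≤ n) {ρ τ : ℝ} (hρ : 0 < ρ) (hτ : 0 < τ)
    (t : ℕ) :
    2 * (τ * (ρ / (n : ℝ) ^ (3 * (t + 1)))) /
        (τ / √((n : ℝ) ^ (t + 1)) * √(2 * Real.pi * (ρ ^ 2 / n))) ≤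
      4 / 5 * (1 / 5) ^ t / (n : ℝ) ^ 2 := by
  have hn' : (2 : ℝ) ≤ n := by exact_mod_cast hn
  have hn0 : (0 : ℝ) < n := by linarith
  have h1 : 5 / 2 * (ρ / √n) ≤ √(2 * Real.pi * (ρ ^ 2 / n)) := by
    refine Real.le_sqrt_of_sq_le ?_
    rw [mul_pow, div_pow ρ, Real.sq_sqrt hn0.le]
    have : 0 < ρ ^ 2 / n := by positivity
    nlinarith [Real.pi_gt_d2]
  have h2 : (5 : ℝ) ^ t * (√((n : ℝ) ^ (t + 1)) * √n) ≤ (n : ℝ) ^ (3 * t + 1) := by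
    rw [← Real.sqrt_mul (by positivity), ← pow_succ]
    refine le_of_sq_le_sq ?_ (by positivity)
    rw [mul_pow, Real.sq_sqrt (by positivity)]
    have h25 : (25 : ℝ) ≤ (n : ℝ) ^ 5 :=
      le_trans (by norm_num) (pow_le_pow_left₀ (by norm_num) hn' 5)
    calc ((5 : ℝ) ^ t) ^ 2 * (n : ℝ) ^ (t + 1 + 1) = 25 ^ t * (n : ℝ) ^ (t + 1 + 1) := by
          rw [← pow_mul, mul_comm t 2, pow_mul]; norm_num
      _ ≤ ((n : ℝ) ^ 5) ^ t * (n : ℝ) ^ (t + 1 + 1) := by gcongr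
      _ = ((n : ℝ) ^ (3 * t + 1)) ^ 2 := by ring
  have hs1 : 0 < √((n : ℝ) ^ (t + 1)) := Real.sqrt_pos.2 (by positivity)
  have hs2 : 0 < √(n : ℝ) := Real.sqrt_pos.2 hn0
  calc 2 * (τ * (ρ / (n : ℝ) ^ (3 * (t + 1)))) /
        (τ / √((n : ℝ) ^ (t + 1)) * √(2 * Real.pi * (ρ ^ 2 / n)))
      ≤ 2 * (τ * (ρ / (n : ℝ) ^ (3 * (t + 1)))) /
        (τ / √((n : ℝ) ^ (t + 1)) * (5 / 2 * (ρ / √n))) := by gcongr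
    _ = 4 / 5 * (1 / 5) ^ t / (n : ℝ) ^ 2 *
        ((5 : ℝ) ^ t * (√((n : ℝ) ^ (t + 1)) * √n) / (n : ℝ) ^ (3 * t + 1)) := by
        have : (n : ℝ) ^ (3 * (t + 1)) = (n : ℝ) ^ (3 * t + 1) * (n : ℝ) ^ 2 := by ring
        rw [this, one_div_pow]
        field_simp
        norm_num
    _ ≤ _ := mul_le_of_le_one_right (by positivity) ((div_le_one (by positivity)).2 h2)

/-- A space of tensors of order `t` and dimension exceeding `t * p * n ^ (t - 1)` contains finitely
many unit tensors, one of which is not small at a perturbed point, except with probability at most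
`n ^ (-2 * (p + 1))`. The factor `1 - 5⁻¹ ^ t` leaves room for the error added by each order. -/
theorem exists_finset_small_ball {n : ℕ} (hn : 2 ≤ n) (p t : ℕ) (V : Submodule ℝ (RealTensor n t))
    (hV : t * p * n ^ t < n * Module.finrank ℝ V) :
    ∃ F : Finset (RealTensor n t), (∀ T ∈ F, T ∈ V ∧ ‖T‖ = 1) ∧
      ∀ ρ : ℝ, 0 < ρ → ∀ x : Fin t → Fin n → ℝ,
        jointPerturbationLaw ρ x {y | ∀ T ∈ F, |T.apply y| < smallBallRadius n ρ t} ≤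
          ENNReal.ofReal (((1 - (1 / 5) ^ t) / (n : ℝ) ^ 2) ^ (p + 1)) := by
  classical
  induction t with
  | zero =>
    have hV0 : V ≠ ⊥ := by
      rintro rfl
      simp at hV
    obtain ⟨T, hTV, hT0⟩ := V.exists_mem_ne_zero_of_ne_bot hV0
    have hnorm : ‖‖T‖⁻¹ • T‖ = 1 := by
      rw [norm_smul, norm_inv, norm_norm, inv_mul_cancel₀ (norm_ne_zero_iff.2 hT0)]
    refine ⟨{‖T‖⁻¹ • T}, by simpa [hnorm] using V.smul_mem _ hTV, fun ρ _ x => ?_⟩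
    -- A tensor of order `0` is a scalar, here of absolute value `1`, which is the threshold.
    have hempty : {y | ∀ S ∈ ({‖T‖⁻¹ • T} : Finset (RealTensor n 0)),
        |S.apply y| < smallBallRadius n ρ 0} = ∅ := by
      refine Set.eq_empty_of_forall_notMem fun y hy => ?_
      have h1 := hy _ (Finset.mem_singleton_self _)
      rw [EuclideanSpace.norm_eq, Fintype.sum_unique, Real.norm_eq_abs, sq_abs,
        Real.sqrt_sq_eq_abs] at hnorm
      rw [RealTensor.apply, Fintype.sum_unique, Finset.univ_eq_empty, Finset.prod_empty, mul_one,
        hnorm, smallBallRadius] at h1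
      exact lt_irrefl _ h1
    rw [hempty, measure_empty]
    exact zero_le
  | succ t ih =>
    have hn0 : 0 < n := by omega
    have hn' : (0 : ℝ) < n := by exact_mod_cast hn0
    have hV' : t * p * n ^ t + (p + 1) * n ^ t < Module.finrank ℝ V + n ^ t := by
      have : (t + 1) * p * n ^ t < Module.finrank ℝ V := by
        refine Nat.lt_of_mul_lt_mul_left (a := n) (lt_of_eq_of_lt ?_ hV)
        ring
      linarith [show (t + 1) * p * n ^ t + n ^ t = t * p * n ^ t + (p + 1) * n ^ t by ring]
    obtain ⟨i, W, hW, hlift⟩ := exists_triangular_slices (by omega) _ _ V hV'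
    choose F hF hprob using fun a => ih (W a) (hW a)
    choose! L hLV hL0 hLw hLn using hlift
    have hw0 : ∀ a, ∀ w ∈ F a, 0 < ‖L a w‖ := fun a w hw => by
      refine norm_pos_iff.2 fun h => ?_
      have h1 := hLw a w (hF a w hw).1
      have h2 := (hF a w hw).2
      rw [h, map_zero] at h1
      rw [← h1, norm_zero] at h2
      exact zero_ne_one h2
    refine ⟨Finset.univ.biUnion fun a => (F a).image fun w => ‖L a w‖⁻¹ • L a w, ?_,
      fun ρ hρ x => ?_⟩
    · intro T hT
      simp only [Finset.mem_biUnion, Finset.mem_univ, true_and, Finset.mem_image] at hT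
      obtain ⟨a, w, hw, rfl⟩ := hT
      refine ⟨V.smul_mem _ (hLV a w (hF a w hw).1), ?_⟩
      rw [norm_smul, norm_inv, norm_norm, inv_mul_cancel₀ (hw0 a w hw).ne']
    set τ := smallBallRadius n ρ t with hτdef
    have hτ : 0 < τ := smallBallRadius_pos hn0 hρ t
    set τ' := smallBallRadius n ρ (t + 1) with hτ'def
    set e : ℝ := 4 / 5 * (1 / 5) ^ t / (n : ℝ) ^ 2 with he
    set α : ℝ := (1 - (1 / 5) ^ t) / (n : ℝ) ^ 2 with hα
    have he0 : 0 ≤ e := by positivity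
    have hα0 : 0 ≤ α :=
      div_nonneg (sub_nonneg.2 (pow_le_one₀ (by norm_num) (by norm_num))) (by positivity)
    set E : Fin (p + 1) → Set (Fin t → Fin n → ℝ) := fun a => {z | ∀ w ∈ F a, |w.apply z| < τ}
    have hE : ∀ a, MeasurableSet (E a) := fun a => measurableSet_forall_abs_apply_lt (F a) τ
    -- The first vector, conditionally on the others: the slices on which the others succeed give a
    -- triangular system of linear forms.
    have hcond : ∀ z : Fin t → Fin n → ℝ, perturbationLaw ρ (x 0) {y | ∀ T ∈
        Finset.univ.biUnion fun a => (F a).image fun w => ‖L a w‖⁻¹ • L a w,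
        |T.apply (Fin.cons y z)| < τ'} ≤
        ((p + 1 : ℕ) : ℝ≥0∞)⁻¹ * ∑ a, (ENNReal.ofReal e ^ (p + 1) + (E a).indicator 1 z) := by
      intro z
      set G : Set (Fin (p + 1)) := {a | z ∉ E a} with hG
      have hGw : ∀ a ∈ G, ∃ w ∈ F a, τ ≤ |w.apply z| := fun a ha => by
        by_contra! h
        exact ha h
      choose! w hwF hwτ using hGw
      set c : Fin (p + 1) → Fin n → ℝ := fun a j =>
        ‖L a (w a)‖⁻¹ * (sliceMap j (L a (w a))).apply z with hc
      have hpivot : ∀ a ∈ G, τ / √((n : ℝ) ^ (t + 1)) ≤ |c a (i a)| := fun a ha => by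
        have h1 := hLn a (w a) (hF a _ (hwF a ha)).1
        rw [(hF a _ (hwF a ha)).2, one_pow, mul_one] at h1
        have h2 := Real.le_sqrt_of_sq_le h1
        have h3 := hw0 a _ (hwF a ha)
        simp only [hc]
        rw [hLw a _ (hF a _ (hwF a ha)).1, abs_mul, abs_inv, abs_norm, inv_mul_eq_div]
        have := hwτ a ha
        gcongr
      have key := pi_forall_abs_linear_lt_le
        (fun j => gaussianReal (x 0 j) (ρ ^ 2 / n).toNNReal) (ENNReal.ofReal e) τ' c i G
        (fun a ha b hb => by
          simp only [hc]
          rw [hL0 a _ (hF a _ (hwF a ha)).1 b hb]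
          simp [RealTensor.apply])
        (fun a ha d => by
          refine (gaussianReal_abs_mul_add_lt_le _ ?_ (by positivity) (hpivot a ha)).trans
            (ENNReal.ofReal_le_ofReal ?_)
          · exact (Real.toNNReal_pos.2 (by positivity)).ne'
          · rw [Real.coe_toNNReal _ (by positivity)]
            exact gaussian_small_ball_constant_le hn hρ hτ t)
      have hsub : {y | ∀ T ∈
          Finset.univ.biUnion fun a => (F a).image fun w => ‖L a w‖⁻¹ • L a w,
          |T.apply (Fin.cons y z)| < τ'} ⊆ {y | ∀ a ∈ G, |∑ j, c a j * y j| < τ'} := by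
        intro y hy a ha
        have h1 := hy (‖L a (w a)‖⁻¹ • L a (w a)) (Finset.mem_biUnion.2
          ⟨a, Finset.mem_univ _, Finset.mem_image.2 ⟨w a, hwF a ha, rfl⟩⟩)
        rw [apply_smul, apply_cons, Finset.mul_sum] at h1
        simpa only [hc, mul_assoc] using h1
      refine (measure_mono hsub).trans (key.trans ?_)
      refine (prod_ite_le_average (Nat.succ_ne_zero p) e.toNNReal G).trans (le_of_eq ?_)
      congr 1
      refine Finset.sum_congr rfl fun a _ => ?_
      congr 1
      by_cases ha : z ∈ E a <;> simp [hG, ha]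
    rw [jointPerturbationLaw_succ_apply ρ x (measurableSet_forall_abs_apply_lt _ τ')]
    -- Average over the other vectors, where the induction hypothesis bounds the measure of
    -- each `E a`.
    calc _ ≤ ∫⁻ z, ((p + 1 : ℕ) : ℝ≥0∞)⁻¹ *
          ∑ a, (ENNReal.ofReal e ^ (p + 1) + (E a).indicator 1 z)
            ∂jointPerturbationLaw ρ fun s => x s.succ := lintegral_mono hcond
      _ = ((p + 1 : ℕ) : ℝ≥0∞)⁻¹ * ∑ a, (ENNReal.ofReal e ^ (p + 1) +
          (jointPerturbationLaw ρ fun s => x s.succ) (E a)) := by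
        have hm : ∀ a, Measurable ((E a).indicator (1 : (Fin t → Fin n → ℝ) → ℝ≥0∞)) :=
          fun a => measurable_one.indicator (hE a)
        rw [lintegral_const_mul _ (Finset.measurable_sum _ fun a _ => (hm a).const_add _),
          lintegral_finsetSum _ fun a _ => (hm a).const_add _]
        congr 1
        refine Finset.sum_congr rfl fun a _ => ?_
        rw [lintegral_add_left measurable_const, lintegral_indicator_one (hE a)]
        simp
      _ ≤ ((p + 1 : ℕ) : ℝ≥0∞)⁻¹ * ∑ _a : Fin (p + 1), (ENNReal.ofReal e ^ (p + 1) +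
          ENNReal.ofReal (α ^ (p + 1))) := by
        gcongr with a
        exact hprob a ρ hρ _
      _ = ENNReal.ofReal (e ^ (p + 1) + α ^ (p + 1)) := by
        rw [Finset.sum_const, Finset.card_univ, Fintype.card_fin, nsmul_eq_mul, ← mul_assoc,
          ENNReal.inv_mul_cancel (by simp) (ENNReal.natCast_ne_top _), one_mul,
          ENNReal.ofReal_add (by positivity) (by positivity), ENNReal.ofReal_pow he0]
      _ ≤ _ := by
        refine ENNReal.ofReal_le_ofReal ((pow_add_pow_le he0 hα0 (Nat.succ_ne_zero p)).trans ?_)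
        refine le_of_eq (congrArg (· ^ (p + 1)) ?_)
        rw [he, hα, pow_succ]
        ring

/-! ### The failure probability -/

/-- With `q + 1 = ⌈δ n / ℓ⌉` the bound `n ^ (-2 (q + 1))` beats `exp (-δ n ^ (2 ^ (-ℓ)))`. Put
`u = n ^ (2 ^ (-ℓ))`: if `u ≤ 5 / 4 ≤ 2 log 2` one factor suffices, and otherwise
`2 n log n = 2 ^ (ℓ + 1) n log u ≥ 4 ℓ u (u - 1) ≥ ℓ u`. -/
theorem inv_sq_pow_le_exp {δ : ℝ} (hδ0 : 0 < δ) (hδ1 : δ < 1) {ℓ n q : ℕ} (hℓ : 1 ≤ ℓ)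
    (hn : 2 ≤ n) (hq : δ * n / ℓ ≤ (q + 1 : ℕ)) :
    (1 / (n : ℝ) ^ 2) ^ (q + 1) ≤ Real.exp (-(δ * (n : ℝ) ^ (1 / (2 : ℝ) ^ ℓ))) := by
  have hn' : (2 : ℝ) ≤ n := by exact_mod_cast hn
  have hn0 : (0 : ℝ) < n := by linarith
  have hℓ' : (0 : ℝ) < ℓ := by exact_mod_cast hℓ
  set u : ℝ := (n : ℝ) ^ (1 / (2 : ℝ) ^ ℓ) with hu
  have hu0 : 0 < u := Real.rpow_pos_of_pos hn0 _
  have hun : u ^ (2 ^ ℓ) = n := by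
    rw [hu, ← Real.rpow_natCast, ← Real.rpow_mul hn0.le]
    simp
  have hL0 : 5 / 4 ≤ 2 * Real.log n := by
    have := Real.log_le_log (by norm_num) hn'
    linarith [Real.log_two_gt_d9]
  have h1 : (1 / (n : ℝ) ^ 2) ^ (q + 1) = Real.exp (-((q + 1 : ℕ) * (2 * Real.log n))) := by
    rw [← mul_neg, Real.exp_nat_mul, Real.exp_neg, mul_comm 2, Real.exp_mul, Real.exp_log hn0,
      one_div]
    norm_num
  rw [h1, Real.exp_le_exp, neg_le_neg_iff]
  have hq1 : (1 : ℝ) ≤ (q + 1 : ℕ) := by push_cast; linarith [Nat.cast_nonneg (α := ℝ) q]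
  rcases le_or_gt u (5 / 4) with h | h
  · calc δ * u ≤ 1 * u := by gcongr
      _ ≤ 1 * (2 * Real.log n) := by linarith
      _ ≤ _ := by gcongr
  · have hlog : Real.log n = 2 ^ ℓ * Real.log u := by
      rw [← hun, Real.log_pow]; push_cast; rfl
    have hlu : u - 1 ≤ u * Real.log u := by
      have := Real.one_sub_inv_le_log_of_pos hu0
      calc u - 1 = u * (1 - u⁻¹) := by field_simp
        _ ≤ _ := by gcongr
    have hlu0 : 0 ≤ Real.log u := Real.log_nonneg (by linarith)
    have h2ℓ : (2 : ℝ) * ℓ ≤ 2 ^ ℓ := by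
      have : 2 * ℓ ≤ 2 ^ ℓ := by
        obtain ⟨k, rfl⟩ := Nat.exists_eq_add_of_le' hℓ
        have := Nat.lt_two_pow_self (n := k)
        rw [pow_succ]
        omega
      exact_mod_cast this
    have hu2 : u * u ≤ n := by
      rw [← hun, ← sq]
      exact pow_le_pow_right₀ (by linarith)
        (by simpa using Nat.pow_le_pow_right (n := 2) two_pos hℓ)
    have hmain : u ≤ n / ℓ * (2 * Real.log n) := by
      rw [div_mul_eq_mul_div, le_div_iff₀ hℓ', hlog]
      calc u * ℓ ≤ u * (4 * (u - 1)) * ℓ := by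
            gcongr
            nlinarith
        _ ≤ u * (4 * (u * Real.log u)) * ℓ := by gcongr
        _ = (u * u) * (2 * (2 * ℓ * Real.log u)) := by ring
        _ ≤ n * (2 * (2 ^ ℓ * Real.log u)) := by gcongr
    calc δ * u ≤ δ * (n / ℓ * (2 * Real.log n)) := by gcongr
      _ = δ * n / ℓ * (2 * Real.log n) := by ring
      _ ≤ _ := by gcongr

/-- The anticoncentration bound in terms of the density `δ` of the space of tensors. -/
theorem exists_finset_anticoncentration {δ : ℝ} (hδ0 : 0 < δ) (hδ1 : δ < 1) {ℓ n : ℕ} (hℓ : 1 ≤ ℓ)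
    (hn : 1 ≤ n) (V : Submodule ℝ (RealTensor n ℓ))
    (hV : (Module.finrank ℝ V : ℝ) = δ * (n : ℝ) ^ ℓ) :
    ∃ F : Finset (RealTensor n ℓ), (∀ T ∈ F, T ∈ V ∧ ‖T‖ = 1) ∧
      ∀ ρ : ℝ, 0 < ρ → ∀ x : Fin ℓ → Fin n → ℝ,
        1 - Real.exp (-(δ * (n : ℝ) ^ (1 / (2 : ℝ) ^ ℓ))) ≤
          (jointPerturbationLaw ρ x).real
            {y | ∃ T ∈ F, ρ ^ ℓ * (1 / (n : ℝ)) ^ (3 ^ ℓ) ≤ |T.apply y|} := by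
  -- For `n = 1` the dimension `δ` would not be an integer.
  have hn2 : 2 ≤ n := by
    by_contra! h
    obtain rfl : n = 1 := by omega
    simp only [Nat.cast_one, one_pow, mul_one] at hV
    rw [← hV] at hδ0 hδ1
    have h0 : 0 < Module.finrank ℝ V := by exact_mod_cast hδ0
    have h1 : Module.finrank ℝ V < 1 := by exact_mod_cast hδ1
    omega
  have hn0 : (0 : ℝ) < n := by exact_mod_cast hn
  have hℓ0 : (0 : ℝ) < ℓ := by exact_mod_cast hℓ
  have hpos : 0 < δ * n / ℓ := by positivity
  obtain ⟨p, hp⟩ := Nat.exists_eq_succ_of_ne_zero (Nat.ceil_pos.2 hpos).ne'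
  have hp1 : (p : ℝ) < δ * n / ℓ := by
    have := Nat.ceil_lt_add_one hpos.le
    rw [hp] at this
    push_cast at this
    linarith
  have hdim : ℓ * p * n ^ ℓ < n * Module.finrank ℝ V := by
    have : (ℓ * p * n ^ ℓ : ℝ) < n * Module.finrank ℝ V := by
      rw [hV]
      rw [lt_div_iff₀ hℓ0] at hp1
      have := mul_lt_mul_of_pos_right hp1 (pow_pos hn0 ℓ)
      linarith
    exact_mod_cast this
  obtain ⟨F, hF, hprob⟩ := exists_finset_small_ball hn2 p ℓ V hdim
  refine ⟨F, hF, fun ρ hρ x => ?_⟩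
  set B : Set (Fin ℓ → Fin n → ℝ) := {y | ∀ T ∈ F, |T.apply y| < smallBallRadius n ρ ℓ} with hB
  have hBm : MeasurableSet B := measurableSet_forall_abs_apply_lt F _
  have hBle : (jointPerturbationLaw ρ x).real B ≤
      Real.exp (-(δ * (n : ℝ) ^ (1 / (2 : ℝ) ^ ℓ))) := by
    have h5 : (0 : ℝ) ≤ 1 - (1 / 5) ^ ℓ :=
      sub_nonneg.2 (pow_le_one₀ (by norm_num) (by norm_num))
    refine (ENNReal.toReal_le_of_le_ofReal (by positivity) (hprob ρ hρ x)).trans ?_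
    refine le_trans (pow_le_pow_left₀ (by positivity) ?_ _)
      (inv_sq_pow_le_exp hδ0 hδ1 hℓ hn2 (q := p)
        (by rw [← Nat.succ_eq_add_one, ← hp]; exact Nat.le_ceil _))
    gcongr
    exact sub_le_self _ (by positivity)
  have hsub : Bᶜ ⊆ {y | ∃ T ∈ F, ρ ^ ℓ * (1 / (n : ℝ)) ^ (3 ^ ℓ) ≤ |T.apply y|} := by
    intro y hy
    by_contra hcon
    refine hy fun T hT => ?_
    by_contra! h
    exact hcon ⟨T, hT, (le_smallBallRadius hn hρ ℓ).trans h⟩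
  refine le_trans ?_ (measureReal_mono hsub)
  rw [probReal_compl_eq_one_sub hBm]
  linarith

/-! ### Right singular vectors -/

/-- The span of the `k` leading right singular vectors: on it `L` dominates `σ_k` times every
functional. -/
theorem exists_submodule_singularValues_mul_abs_inner_le {E F : Type*}
    [NormedAddCommGroup E] [InnerProductSpace ℝ E] [FiniteDimensional ℝ E]
    [NormedAddCommGroup F] [InnerProductSpace ℝ F] [FiniteDimensional ℝ F]
    (L : E →ₗ[ℝ] F) {k : ℕ} (hk : k ≤ Module.finrank ℝ E) :
    ∃ V : Submodule ℝ E, Module.finrank ℝ V = k ∧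
      ∀ T ∈ V, ∀ z, L.singularValues (k - 1) * |inner ℝ T z| ≤ ‖T‖ * ‖L z‖ := by
  set b := L.isSymmetric_adjoint_comp_self.eigenvectorBasis rfl with hb
  have hf : Function.Injective (Fin.castLE hk) := Fin.castLE_injective hk
  have hon : Orthonormal ℝ fun j : Fin k => b (Fin.castLE hk j) := b.orthonormal.comp _ hf
  refine ⟨Submodule.span ℝ (Set.range fun j : Fin k => b (Fin.castLE hk j)), ?_, ?_⟩
  · rw [finrank_span_eq_card hon.linearIndependent, Fintype.card_fin]
  intro T hT z
  obtain ⟨c, rfl⟩ := (Submodule.mem_span_range_iff_exists_fun ℝ).1 hT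
  have hLb : ∀ j, inner ℝ (L (b j)) (L z) = L.singularValues j ^ 2 * inner ℝ (b j) z := fun j => by
    rw [← LinearMap.adjoint_inner_left, L.sq_singularValues_fin rfl j]
    have := L.isSymmetric_adjoint_comp_self.apply_eigenvectorBasis rfl j
    rw [LinearMap.comp_apply] at this
    rw [hb, this, real_inner_smul_left]
    rfl
  set s := L.singularValues (k - 1) with hs
  have hs0 : 0 ≤ s := L.singularValues_nonneg _
  have hnorm : ‖∑ j, c j • b (Fin.castLE hk j)‖ ^ 2 = ∑ j, c j ^ 2 := by
    rw [← real_inner_self_eq_norm_sq, hon.inner_sum]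
    simp [sq]
  have hsum : s ^ 2 * ∑ j : Fin k, inner ℝ (b (Fin.castLE hk j)) z ^ 2 ≤ ‖L z‖ ^ 2 := by
    have hz : inner ℝ (L z) (L z) =
        ∑ j : Fin (Module.finrank ℝ E), L.singularValues j ^ 2 * inner ℝ (b j) z ^ 2 := by
      have hLz : L z = ∑ j, inner ℝ (b j) z • L (b j) := by
        conv_lhs => rw [← b.sum_repr' z, map_sum]
        exact Finset.sum_congr rfl fun j _ => map_smul L _ _
      rw [congrArg (inner ℝ · (L z)) hLz, sum_inner]
      refine Finset.sum_congr rfl fun j _ => ?_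
      rw [real_inner_smul_left, hLb]
      ring
    rw [← real_inner_self_eq_norm_sq, hz, Finset.mul_sum]
    calc ∑ j : Fin k, s ^ 2 * inner ℝ (b (Fin.castLE hk j)) z ^ 2
        ≤ ∑ j : Fin k, L.singularValues (Fin.castLE hk j) ^ 2 *
            inner ℝ (b (Fin.castLE hk j)) z ^ 2 := by
          gcongr with j
          exact L.singularValues_antitone (by have := j.2; simp; omega)
      _ = ∑ j ∈ Finset.univ.map ⟨Fin.castLE hk, hf⟩,
            L.singularValues j ^ 2 * inner ℝ (b j) z ^ 2 := by rw [Finset.sum_map]; rfl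
      _ ≤ _ := Finset.sum_le_sum_of_subset_of_nonneg (Finset.subset_univ _)
          fun j _ _ => by positivity
  have hCS : (inner ℝ (∑ j, c j • b (Fin.castLE hk j)) z) ^ 2 ≤
      (∑ j, c j ^ 2) * ∑ j : Fin k, inner ℝ (b (Fin.castLE hk j)) z ^ 2 := by
    rw [sum_inner]
    simp only [real_inner_smul_left]
    exact Finset.sum_mul_sq_le_sq_mul_sq _ _ _
  refine le_of_sq_le_sq ?_ (by positivity)
  rw [mul_pow, mul_pow, sq_abs, hnorm]
  calc s ^ 2 * (inner ℝ (∑ j, c j • b (Fin.castLE hk j)) z) ^ 2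
      ≤ s ^ 2 * ((∑ j, c j ^ 2) * ∑ j : Fin k, inner ℝ (b (Fin.castLE hk j)) z ^ 2) := by gcongr
    _ = (∑ j, c j ^ 2) * (s ^ 2 * ∑ j : Fin k, inner ℝ (b (Fin.castLE hk j)) z ^ 2) := by ring
    _ ≤ _ := by gcongr

theorem one_sub_exp_rpow_mono {δ : ℝ} (hδ : 0 ≤ δ) {n : ℕ} (hn : 1 ≤ n) {a b : ℝ} (hab : a ≤ b) :
    1 - Real.exp (-(δ * (n : ℝ) ^ a)) ≤ 1 - Real.exp (-(δ * (n : ℝ) ^ b)) := by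
  have hn' : (1 : ℝ) ≤ n := by exact_mod_cast hn
  gcongr

theorem mainTheorem2 :
    (∀ (δ : ℝ), 0 < δ → δ < 1 → ∀ (ℓ n : ℕ), 1 ≤ ℓ → 1 ≤ n →
      ∀ V : Submodule ℝ (RealTensor n ℓ), (Module.finrank ℝ V : ℝ) = δ * (n : ℝ) ^ ℓ →
        ∃ (r : ℕ) (T : Fin r → RealTensor n ℓ), (∀ j, T j ∈ V ∧ ‖T j‖ = 1) ∧
          ∀ (ρ : ℝ), 0 < ρ → ∀ x : Fin ℓ → Fin n → ℝ,
            1 - Real.exp (-(δ * (n : ℝ) ^ (1 / (2 * (ℓ : ℝ)) ^ ℓ))) ≤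
              (jointPerturbationLaw ρ x).real
                {y | ∃ j, ρ ^ ℓ * (1 / (n : ℝ)) ^ (3 ^ ℓ) ≤ |(T j).apply y|}) ∧
    (∃ C : ℕ, ∀ (δ : ℝ), 0 < δ → δ < 1 → ∀ (ℓ n : ℕ), 1 ≤ ℓ → 1 ≤ n →
      ∀ (r : ℕ) (M : Matrix (Fin r) (Fin ℓ → Fin n) ℝ) (k : ℕ) (η : ℝ),
        (k : ℝ) = δ * (n : ℝ) ^ ℓ → η ≤ M.sigma k →
          ∀ (ρ : ℝ), 0 < ρ → ∀ x : Fin ℓ → Fin n → ℝ,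
            1 - Real.exp (-(δ * (n : ℝ) ^ (1 / (3 : ℝ) ^ ℓ))) ≤
              (jointPerturbationLaw ρ x).real
                {y | η * ρ ^ ℓ * (1 / (n : ℝ)) ^ (3 ^ (C * ℓ)) ≤
                  ‖Matrix.toEuclideanLin M (rankOneTensor y)‖}) := by
  refine ⟨fun δ hδ0 hδ1 ℓ n hℓ hn V hV => ?_, 1, fun δ hδ0 hδ1 ℓ n hℓ hn r M k η hk hη ρ hρ x => ?_⟩
  · obtain ⟨F, hF, hprob⟩ := exists_finset_anticoncentration hδ0 hδ1 hℓ hn V hV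
    refine ⟨F.card, fun j => F.equivFin.symm j, fun j => hF _ (F.equivFin.symm j).2,
      fun ρ hρ x => ?_⟩
    have hℓ' : (1 : ℝ) ≤ ℓ := by exact_mod_cast hℓ
    refine (one_sub_exp_rpow_mono hδ0.le hn ?_).trans ((hprob ρ hρ x).trans (measureReal_mono ?_))
    · gcongr
      linarith
    · rintro y ⟨T, hT, h⟩
      exact ⟨F.equivFin ⟨T, hT⟩, by simpa using h⟩
  · have hkn : k ≤ Module.finrank ℝ (RealTensor n ℓ) := by
      rw [finrank_realTensor]
      have : (k : ℝ) ≤ (n : ℝ) ^ ℓ := by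
        rw [hk]
        exact mul_le_of_le_one_left (by positivity) hδ1.le
      exact_mod_cast this
    obtain ⟨V, hVk, hV⟩ :=
      exists_submodule_singularValues_mul_abs_inner_le (Matrix.toEuclideanLin M) hkn
    obtain ⟨F, hF, hprob⟩ := exists_finset_anticoncentration hδ0 hδ1 hℓ hn V (by rw [hVk, hk])
    refine (one_sub_exp_rpow_mono hδ0.le hn ?_).trans ((hprob ρ hρ x).trans (measureReal_mono ?_))
    · gcongr
      norm_num
    · rintro y ⟨T, hT, h⟩
      have h1 := hV T (hF T hT).1 (rankOneTensor y)
      rw [(hF T hT).2, one_mul, ← apply_eq_inner] at h1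
      rw [Set.mem_ofPred_eq, one_mul, mul_assoc]
      refine le_trans ?_ h1
      have hs0 : 0 ≤ M.sigma k := LinearMap.singularValues_nonneg _ _
      calc η * (ρ ^ ℓ * (1 / (n : ℝ)) ^ 3 ^ ℓ)
          ≤ M.sigma k * (ρ ^ ℓ * (1 / (n : ℝ)) ^ 3 ^ ℓ) := by gcongr
        _ ≤ M.sigma k * |T.apply y| := by gcongr
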